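/- Let $R=K[x_1,\dots,x_n]$ be a polynomial ring over a field with a monomial order $<$, and let $f_1,\dots,f_m\in R$ be a regular sequence: $f_i$ is a non-zero-divisor on $R/\langle f_1,\dots,f_{i-1}\rangle$ for every $i=1,\dots,m$ (so $f_1\neq 0$; the quotient $R/\langle f_1,\dots,f_m\rangle$ may be zero). Let $e_1,\dots,e_m$ be the unit vectors of $R^m$, let $\overline{\alpha}=\sum_i a_if_i$ be the image of $\alpha=\sum_i a_ie_i\in R^m$ in $R$, and order the module monomials by $<_{\mathrm{pot}}$: $a e_i<_{\mathrm{pot}} b e_j$ iff $i<j$, or $i=j$ and $a<b$. The signature $\mathfrak s(\alpha)$ is the $<_{\mathrm{pot}}$-largest module monomial of $\alpha\ne 0$ (coefficients of signatures are disregarded). A regular s-reduction step of $\alpha$ with respect to $G\subset R^m$ replaces $\alpha$ by $\alpha-b\beta$, where $\beta\in G$, $b$ is a monomial, $\mathrm{lt}(\overline{b\beta})$ is a term of $\overline\alpha$, and $\mathfrak s(b\beta)<_{\mathrm{pot}}\mathfrak s(\alpha)$; a result of regular s-reducing $\alpha$ is obtained by finitely many such steps and admits no further one. For $\overline\alpha,\overline\beta\neq0$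 the S-pair of $\alpha$ and $\beta$ is $\frac{\lambda}{\mathrm{lt}(\overline\alpha)}\alpha-\frac{\lambda}{\mathrm{lt}(\overline\beta)}\beta$ with $\lambda=\mathrm{lcm}(\mathrm{lt}(\overline\alpha),\mathrm{lt}(\overline\beta))$; it is regular if its two parts have different signatures. A rewrite order $\lhd$ is a strict order on the basis elements (elements with nonzero image, each with the time at which it was added), total on elements that have different signatures and different times, that is admissible: $\alpha\lhd\gamma$ whenever $\gamma$ was added after $\alpha$ and $\mathfrak s(\gamma)=\mathfrak s(a\alpha)$, $\mathrm{lt}(\overline\gamma)<\mathrm{lt}(\overline{a\alpha})$ (coefficients disregarded) for some monomial $a$. Examples are $\lhd_{\mathrm{add}}$ (order of addition) and $\lhd_{\mathrm{rat}}$ ($\alpha\lhd_{\mathrm{rat}}\beta$ iff $\mathfrak s(\alpha)\,\mathrm{lt}(\overline\beta)<\mathfrak s(\beta)\,\mathrm{lt}(\overline\alpha)$, or equality holds and $\mathfrak s(\alpha)<\mathfrak s(\beta)$). Elements of the set $H$ of known syzygies rank above all basis elements. The algorithm RB starts with $G=\emptyset$, $H=\{f_ie_j-f_je_i\mid i<j\}$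 and the pair set $P=\{e_1,\dots,e_m\}$. While $P\ne\emptyset$ it removes from $P$ an element $p$ of minimal signature (ties broken arbitrarily). If $p=e_i$, it first adds to $H$ the Koszul syzygies $\overline{\alpha}\,e_i-f_i\,\alpha$ for all $\alpha$ in the current basis $G$. It discards $p$ if $p$ is rewritable: $p=e_i$ is rewritable if $\mathfrak s(h)\mid e_i$ for some nonzero $h\in H$, and an S-pair $a\alpha-b\beta$ is rewritable if $a\alpha$ or $b\beta$ is, where $a\alpha$ is rewritable if $\mathfrak s(h)\mid\mathfrak s(a\alpha)$ for some nonzero $h\in H$ or $\mathfrak s(\delta)\mid\mathfrak s(a\alpha)$ for some $\delta\in G$ with $\alpha\lhd\delta$. Otherwise it regular s-reduces $p$ with respect to $G$ to some $\gamma$. If $\overline\gamma=0$ (an s-reduction to zero), it adds $\gamma$ to $H$; if $\overline\gamma\ne0$, it adds to $P$ all regular S-pairs of $\gamma$ with elements of $G$, and then adds $\gamma$ to $G$. Then, for every rewrite order as above, no s-reduction to zero occurs in any run of RB on the input $f_1,\dots,f_m$ with $<_{\mathrm{pot}}$: every reduction that RB performs ends in an element $\gamma$ with $\overline\gamma\neq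 0$. -/

import Mathlib

open MvPolynomial

namespace SigGB

noncomputable section

/-- Elements of the free module `R^m`, where `R = K[x_s : s ∈ σ]`. -/
abbrev FreeMod (σ K : Type*) [Field K] (m : ℕ) : Type _ := Fin m → MvPolynomial σ K

/-- Monic module monomials `x^d e_i`, ordered position over term: `x^d e_i < x^d' e_j` iff
`i < j`, or `i = j` and `x^d < x^d'`. -/
abbrev ModMon {σ : Type*} (mo : MonomialOrder σ) (m : ℕ) : Type _ := Fin m ×ₗ mo.syn

variable {σ K : Type*} [Field K] {m : ℕ}

/-- The homomorphism `R^m → R`, `e_i ↦ f_i`. -/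
def proj (f : Fin m → MvPolynomial σ K) (α : FreeMod σ K m) : MvPolynomial σ K :=
  ∑ i, α i * f i

/-- The (monic) signature of `α`: the position-over-term largest module monomial that occurs
in `α`; it is `⊥` exactly for `α = 0`. -/
def sig (mo : MonomialOrder σ) (α : FreeMod σ K m) : WithBot (ModMon mo m) :=
  Finset.univ.sup fun i => (α i).support.sup fun d =>
    ((toLex (i, mo.toSyn d) : ModMon mo m) : WithBot (ModMon mo m))

/-- The unit vector `e_i`. -/
def basisVec (σ K : Type*) [Field K] {m : ℕ} (i : Fin m) : FreeMod σ K m := Pi.single i 1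

/-- The Koszul syzygy between `α` and `β`. -/
def koszul (f : Fin m → MvPolynomial σ K) (α β : FreeMod σ K m) : FreeMod σ K m :=
  proj f β • α - proj f α • β

/-! ### S-pairs -/

/-- The exponent of `lcm (lt α) (lt β) / lt α`, where `lt` is the lead term of the image
in `R`. -/
def cofactor (mo : MonomialOrder σ) (f : Fin m → MvPolynomial σ K) (α β : FreeMod σ K m) :
    σ →₀ ℕ :=
  (mo.degree (proj f α) ⊔ mo.degree (proj f β)) - mo.degree (proj f α)

/-- The multiple `(λ / lt α) α` that enters the S-pair of `α` and `β`, `λ` being the monic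
least common multiple of the two lead terms. -/
def spairPart (mo : MonomialOrder σ) (f : Fin m → MvPolynomial σ K) (α β : FreeMod σ K m) :
    FreeMod σ K m :=
  monomial (cofactor mo f α β) (mo.leadingCoeff (proj f α))⁻¹ • α

/-- The S-pair of `α` and `β`. -/
def spair (mo : MonomialOrder σ) (f : Fin m → MvPolynomial σ K) (α β : FreeMod σ K m) :
    FreeMod σ K m :=
  spairPart mo f α β - spairPart mo f β α

/-- The S-pair of `α` and `β` is regular: its two parts have different signatures. -/
def RegularSPair (mo : MonomialOrder σ) (f : Fin m → MvPolynomial σ K) (α β : FreeMod σ K m) :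
    Prop :=
  sig mo (spairPart mo f α β) ≠ sig mo (spairPart mo f β α)

/-! ### Regular s-reduction -/

/-- One regular s-reduction step of `α` to `α'` with respect to `G`: some term
`t` (with exponent `e`) of the image of `α` equals the lead term of the image of `bβ`, where
`β ∈ G` and `b` is a monomial, `bβ` has signature strictly below that of `α`, and
`α' = α - bβ`. The term `t` may or may not be the lead term. -/
def RegularSRedStep (mo : MonomialOrder σ) (f : Fin m → MvPolynomial σ K)
    (G : List (FreeMod σ K m)) (α α' : FreeMod σ K m) : Prop :=
  ∃ β ∈ G, ∃ (d : σ →₀ ℕ) (c : K), ∃ e ∈ (proj f α).support,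
    mo.leadingTerm (proj f (monomial d c • β)) = monomial e (coeff e (proj f α)) ∧
    sig mo (monomial d c • β) < sig mo α ∧
    α' = α - monomial d c • β

/-- `γ` is a result of regular s-reducing `β` with respect to `G`: it is reached by
finitely many regular s-reduction steps and admits no further one. -/
def RegularSReduces (mo : MonomialOrder σ) (f : Fin m → MvPolynomial σ K)
    (G : List (FreeMod σ K m)) (β γ : FreeMod σ K m) : Prop :=
  Relation.ReflTransGen (RegularSRedStep mo f G) β γ ∧ ∀ δ, ¬ RegularSRedStep mo f G γ δ

/-! ### Rewrite orders

A basis element is kept together with the time (position in the list `G`) at which it was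
added, since a rewrite order may depend on that time. -/

/-- A basis element together with its position in the basis. -/
abbrev Entry (σ K : Type*) [Field K] (m : ℕ) : Type _ := ℕ × FreeMod σ K m

/-- `x` is an entry of the basis `G`. -/
def IsEntry (G : List (FreeMod σ K m)) (x : Entry σ K m) : Prop := G[x.1]? = some x.2

/-- Strict rewrite orders on basis elements (elements with nonzero image): strict orders
that are total on elements with different positions and signatures and are admissible: if `y` was added
later than `x`, has the signature of a multiple `a x`, and has a smaller lead term than
`a x` (as happens when `y` results from reducing an S-pair with leading part `a x`), then
`y` is larger than `x`. -/
structure IsRewriteOrder (mo : MonomialOrder σ) (f : Fin m → MvPolynomial σ K)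
    (lt : Entry σ K m → Entry σ K m → Prop) : Prop where
  irrefl : ∀ x, proj f x.2 ≠ 0 → ¬ lt x x
  trans : ∀ x y z, proj f x.2 ≠ 0 → proj f y.2 ≠ 0 → proj f z.2 ≠ 0 →
    lt x y → lt y z → lt x z
  total : ∀ x y, proj f x.2 ≠ 0 → proj f y.2 ≠ 0 → x.1 ≠ y.1 →
    sig mo x.2 ≠ sig mo y.2 → lt x y ∨ lt y x
  admissible : ∀ x y, proj f x.2 ≠ 0 → proj f y.2 ≠ 0 → x.1 < y.1 →
    ∀ a : σ →₀ ℕ, sig mo y.2 = sig mo (monomial a (1 : K) • x.2) →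
      mo.toSyn (mo.degree (proj f y.2)) <
        mo.toSyn (mo.degree (proj f (monomial a (1 : K) • x.2))) → lt x y

/-- The rewrite order by time of addition: later elements are larger. -/
def addOrder (x y : Entry σ K m) : Prop := x.1 < y.1

/-- The rewrite order by ratio of signature and lead term:
`sig x · lt y < sig y · lt x`, or equality holds and `sig x < sig y`. -/
def ratOrder (mo : MonomialOrder σ) (f : Fin m → MvPolynomial σ K) (x y : Entry σ K m) : Prop :=
  sig mo (monomial (mo.degree (proj f y.2)) (1 : K) • x.2) <
      sig mo (monomial (mo.degree (proj f x.2)) (1 : K) • y.2) ∨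
    (sig mo (monomial (mo.degree (proj f y.2)) (1 : K) • x.2) =
      sig mo (monomial (mo.degree (proj f x.2)) (1 : K) • y.2) ∧ sig mo x.2 < sig mo y.2)

/-! ### The algorithm RB for the position-over-term order -/

/-- The elements of the pair set: the unit vectors `e_i`, and S-pairs of basis elements. -/
inductive Item (σ K : Type*) [Field K] (m : ℕ) : Type _
  | unit (i : Fin m) : Item σ K m
  | pair (x y : Entry σ K m) : Item σ K m

/-- The module element that an item of the pair set stands for. -/
def Item.elem (mo : MonomialOrder σ) (f : Fin m → MvPolynomial σ K) :
    Item σ K m → FreeMod σ K m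
  | .unit i => basisVec σ K i
  | .pair x y => spair mo f x.2 y.2

/-- A state of RB: the basis `G` in order of addition, the set `H` of known syzygies, and the
pair set `P`. -/
structure State (σ K : Type*) [Field K] (m : ℕ) where
  G : List (FreeMod σ K m)
  H : Set (FreeMod σ K m)
  P : Set (Item σ K m)

/-- The initial state: no basis element, the Koszul syzygies of the input, and all `e_i`. -/
def initState (f : Fin m → MvPolynomial σ K) : State σ K m where
  G := []
  H := {h | ∃ i j : Fin m, i < j ∧ h = f i • basisVec σ K j - f j • basisVec σ K i}
  P := {p | ∃ i : Fin m, p = .unit i}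

/-- The known syzygies used for treating an item: when the computations in a new
index start with `e_i`, the Koszul syzygies between `e_i` and all elements of the intermediate
basis are added. -/
def State.updH (f : Fin m → MvPolynomial σ K) (S : State σ K m) : Item σ K m →
    Set (FreeMod σ K m)
  | .unit i => S.H ∪ {h | ∃ α ∈ S.G, h = koszul f (basisVec σ K i) α}
  | .pair _ _ => S.H

/-- `α` has a multiple by a monomial whose signature is `T`, that is, `sig α` divides `T`. -/
def SigDvd (mo : MonomialOrder σ) (α : FreeMod σ K m) (T : WithBot (ModMon mo m)) : Prop :=
  ∃ c : σ →₀ ℕ, sig mo (monomial c (1 : K) • α) = T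

/-- A multiple of the basis element `x` with signature `T` is rewritable: `x` is
not the canonical rewriter in signature `T`, because of an element of `H` (all of which rank
above the basis elements) or because of a basis element that is larger in the rewrite
order `lt`. -/
def MulRewritable (mo : MonomialOrder σ) (lt : Entry σ K m → Entry σ K m → Prop)
    (G : List (FreeMod σ K m)) (H : Set (FreeMod σ K m)) (x : Entry σ K m)
    (T : WithBot (ModMon mo m)) : Prop :=
  (∃ h ∈ H, SigDvd mo h T) ∨ ∃ y, IsEntry G y ∧ lt x y ∧ SigDvd mo y.2 T

/-- The rewritability check. An S-pair is rewritable if one of its two parts is; `e_i`, which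
does not come from a basis element, is rewritable if a known syzygy has a signature
dividing it. -/
def Rewritable (mo : MonomialOrder σ) (f : Fin m → MvPolynomial σ K)
    (lt : Entry σ K m → Entry σ K m → Prop)
    (G : List (FreeMod σ K m)) (H : Set (FreeMod σ K m)) : Item σ K m → Prop
  | .unit i => ∃ h ∈ H, SigDvd mo h (sig mo (basisVec σ K i))
  | .pair x y =>
      MulRewritable mo lt G H x (sig mo (spairPart mo f x.2 y.2)) ∨
      MulRewritable mo lt G H y (sig mo (spairPart mo f y.2 x.2))

/-- In state `S`, RB may choose the item `p`: it has minimal signature in the pair set (ties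
are broken arbitrarily). -/
def MayPick (mo : MonomialOrder σ) (f : Fin m → MvPolynomial σ K) (S : State σ K m)
    (p : Item σ K m) : Prop :=
  p ∈ S.P ∧ ∀ q ∈ S.P, sig mo (p.elem mo f) ≤ sig mo (q.elem mo f)

/-- In state `S`, RB may choose the item `p`, not discard it, and regular s-reduce it
to `γ`. -/
def PerformsReduction (mo : MonomialOrder σ) (f : Fin m → MvPolynomial σ K)
    (lt : Entry σ K m → Entry σ K m → Prop) (S : State σ K m) (p : Item σ K m)
    (γ : FreeMod σ K m) : Prop :=
  MayPick mo f S p ∧ ¬ Rewritable mo f lt S.G (S.updH f p) p ∧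
    RegularSReduces mo f S.G (p.elem mo f) γ

/-- One pass through the main loop of RB. -/
inductive RBStep (mo : MonomialOrder σ) (f : Fin m → MvPolynomial σ K)
    (lt : Entry σ K m → Entry σ K m → Prop) : State σ K m → State σ K m → Prop
  | discard (S : State σ K m) (p : Item σ K m) (hp : MayPick mo f S p)
      (hr : Rewritable mo f lt S.G (S.updH f p) p) :
      RBStep mo f lt S ⟨S.G, S.updH f p, S.P \ {p}⟩
  | syzygy (S : State σ K m) (p : Item σ K m) (γ : FreeMod σ K m)
      (hp : PerformsReduction mo f lt S p γ) (hγ : proj f γ = 0) :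
      RBStep mo f lt S ⟨S.G, insert γ (S.updH f p), S.P \ {p}⟩
  | basis (S : State σ K m) (p : Item σ K m) (γ : FreeMod σ K m)
      (hp : PerformsReduction mo f lt S p γ) (hγ : proj f γ ≠ 0) :
      RBStep mo f lt S ⟨S.G ++ [γ], S.updH f p,
        (S.P \ {p}) ∪ {q | ∃ x, IsEntry S.G x ∧ RegularSPair mo f x.2 γ ∧
          q = .pair x (S.G.length, γ)}⟩

/-- `S` occurs in a run of RB on the input `f` with rewrite order `lt`. -/
def RBReachable (mo : MonomialOrder σ) (f : Fin m → MvPolynomial σ K)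
    (lt : Entry σ K m → Entry σ K m → Prop) (S : State σ K m) : Prop :=
  Relation.ReflTransGen (RBStep mo f lt) (initState f) S

/-! ### Order by time and order by ratio are rewrite orders -/

theorem proj_smul (f : Fin m → MvPolynomial σ K) (r : MvPolynomial σ K) (α : FreeMod σ K m) :
    proj f (r • α) = r * proj f α := by
  simp [proj, Finset.mul_sum, mul_assoc]

theorem degree_proj_monomial_smul (mo : MonomialOrder σ) (f : Fin m → MvPolynomial σ K)
    (c : σ →₀ ℕ) (α : FreeMod σ K m) (h : proj f α ≠ 0) :
    mo.degree (proj f (monomial c (1 : K) • α)) = c + mo.degree (proj f α) := by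
  classical
  rw [proj_smul, mo.degree_mul (by simp) h, mo.degree_monomial]
  simp

/-- Multiplication of a module monomial by `x^c`. -/
def shift (mo : MonomialOrder σ) (c : σ →₀ ℕ) (p : ModMon mo m) : ModMon mo m :=
  toLex ((ofLex p).1, mo.toSyn c + (ofLex p).2)

theorem shift_strictMono (mo : MonomialOrder σ) (c : σ →₀ ℕ) :
    StrictMono (shift (m := m) mo c) := by
  intro p q h
  rw [Prod.Lex.lt_iff] at h ⊢
  rcases h with h | ⟨h, h'⟩
  · exact Or.inl h
  · exact Or.inr ⟨h, by simpa [shift] using h'⟩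

theorem shift_shift (mo : MonomialOrder σ) (c d : σ →₀ ℕ) (T : WithBot (ModMon mo m)) :
    (T.map (shift mo c)).map (shift mo d) = T.map (shift mo (c + d)) := by
  cases T with
  | bot => rfl
  | coe p =>
    simp only [WithBot.map_coe, shift, ofLex_toLex, map_add]
    rw [← add_assoc, add_comm (mo.toSyn d)]

theorem map_shift_strictMono (mo : MonomialOrder σ) (c : σ →₀ ℕ) :
    StrictMono (WithBot.map (shift (m := m) mo c)) :=
  (shift_strictMono mo c).withBot_map

theorem sig_monomial_smul (mo : MonomialOrder σ) (c : σ →₀ ℕ) (α : FreeMod σ K m) :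
    sig mo (monomial c (1 : K) • α) = (sig mo α).map (shift mo c) := by
  have hm : Monotone (WithBot.map (shift (m := m) mo c)) := (map_shift_strictMono mo c).monotone
  unfold sig
  rw [Finset.apply_sup_eq_sup_comp (WithBot.map (shift mo c)) hm.map_sup rfl]
  congr 1
  funext i
  rw [Function.comp, Finset.apply_sup_eq_sup_comp (WithBot.map (shift mo c)) hm.map_sup rfl]
  have hs : ((monomial c (1 : K) • α) i).support = (α i).support.map (addLeftEmbedding c) := by
    classical
    ext d
    simp only [Pi.smul_apply, smul_eq_mul, mem_support_iff, coeff_monomial_mul', one_mul,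
      Finset.mem_map, addLeftEmbedding_apply, ite_ne_right_iff]
    constructor
    · rintro ⟨h1, h2⟩
      exact ⟨d - c, h2, add_tsub_cancel_of_le h1⟩
    · rintro ⟨e, h2, rfl⟩
      exact ⟨le_self_add, by simpa using h2⟩
  rw [hs, Finset.sup_map]
  congr 1
  funext d
  simp [shift]

theorem sig_ne_bot (mo : MonomialOrder σ) (f : Fin m → MvPolynomial σ K) (α : FreeMod σ K m)
    (h : proj f α ≠ 0) : sig mo α ≠ ⊥ := by
  intro hb
  apply h
  unfold sig at hb
  simp only [Finset.sup_eq_bot_iff, WithBot.coe_ne_bot, imp_false] at hb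
  unfold proj
  refine Finset.sum_eq_zero fun i _ => ?_
  rw [support_eq_empty.mp (Finset.eq_empty_of_forall_notMem (hb i (Finset.mem_univ i))), zero_mul]

theorem addOrder_isRewriteOrder (mo : MonomialOrder σ) (f : Fin m → MvPolynomial σ K) :
    IsRewriteOrder mo f addOrder :=
  ⟨fun _ _ => lt_irrefl _, fun _ _ _ _ _ _ h k => h.trans k,
    fun _ _ _ _ h _ => lt_or_gt_of_ne h, fun _ _ _ _ h _ _ _ => h⟩

theorem ratOrder_isRewriteOrder (mo : MonomialOrder σ) (f : Fin m → MvPolynomial σ K) :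
    IsRewriteOrder mo f (ratOrder mo f) := by
  refine ⟨?_, ?_, ?_, ?_⟩
  · simp [ratOrder]
  · intro x y z _ _ _ h k
    simp only [ratOrder, sig_monomial_smul] at *
    set dx := mo.degree (proj f x.2)
    set dy := mo.degree (proj f y.2)
    set dz := mo.degree (proj f z.2)
    have e1 : ∀ c d T, WithBot.map (shift (m := m) mo c) (WithBot.map (shift mo d) T) =
        WithBot.map (shift mo d) (WithBot.map (shift mo c) T) := fun c d T => by
      rw [shift_shift, shift_shift, add_comm]
    have hz := map_shift_strictMono (m := m) mo dz
    have hx := map_shift_strictMono (m := m) mo dx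
    have hy := map_shift_strictMono (m := m) mo dy
    rcases h with h | ⟨h, h'⟩ <;> rcases k with k | ⟨k, k'⟩
    · left
      rw [← hy.lt_iff_lt, e1, e1 dy dx]
      exact (hz h).trans (by rw [e1]; exact hx k)
    · left
      rw [← hy.lt_iff_lt, e1, e1 dy dx, ← k, e1 dx dz]
      exact hz h
    · left
      rw [← hy.lt_iff_lt, e1, e1 dy dx, h, e1 dz dx]
      exact hx k
    · right
      refine ⟨hy.injective ?_, h'.trans k'⟩
      rw [e1, h, e1, k, e1]
  · intro x y _ _ _ hne
    simp only [ratOrder]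
    rcases lt_trichotomy (sig mo (monomial (mo.degree (proj f y.2)) (1 : K) • x.2))
      (sig mo (monomial (mo.degree (proj f x.2)) (1 : K) • y.2)) with h | h | h
    · exact Or.inl (Or.inl h)
    · rcases lt_or_gt_of_ne hne with h' | h'
      · exact Or.inl (Or.inr ⟨h, h'⟩)
      · exact Or.inr (Or.inr ⟨h.symm, h'⟩)
    · exact Or.inr (Or.inl h)
  · intro x y hx _ _ a hs hd
    left
    rw [degree_proj_monomial_smul mo f a x.2 hx] at hd
    rw [sig_monomial_smul, sig_monomial_smul, hs, sig_monomial_smul, shift_shift]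
    obtain ⟨p, hp⟩ := WithBot.ne_bot_iff_exists.mp (sig_ne_bot mo f x.2 hx)
    rw [← hp, WithBot.map_coe, WithBot.map_coe, WithBot.coe_lt_coe, Prod.Lex.lt_iff]
    right
    exact ⟨rfl, by simpa [shift] using hd⟩


end

end SigGB

namespace SigGB

variable {σ K : Type*} [Field K] {m : ℕ}

/-! ### The homomorphism `proj` -/

/-! Suppose a reduction ends in `γ` with image zero and signature `x^d e_i`. Components of `γ`
beyond `i` vanish, so `γ i * f i` lies in the ideal of the earlier `f j`. By regularity so does `γ
i` (`mem_ofList_of_proj_eq_zero`), hence `γ i = proj f α` with `𝔰(α) < e_i`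
(`exists_proj_eq_of_mem_ofList`). When `e_i` was chosen, the basis was a signature Gröbner basis
below `e_i`, so some basis element `g` with `𝔰(g) < e_i` has a lead term dividing that of `γ i`. The
Koszul syzygy of `e_i` and `g`, added at that moment, has signature `lt(g) e_i`, which divides `x^d
e_i`. Since s-reduction preserves signatures, the item was rewritable and could not have been
reduced.

The main work is the Gröbner property, `Invariant.exists_reducer`: if every pending item has
signature at least `T₀`, each element below `T₀` with nonzero image has a basis multiple with the
same lead exponent, no larger signature, and not rewritable. It is proved by induction on the
signature. The crux is `Invariant.mulRewritable_of_regular_reducer`: a multiple that is not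
rewritable has only rewritable regular top reducers, since the corresponding S-pair has been treated
and the rewrite order is admissible. `Invariant.rbStep` carries the required invariant through the
run. -/

theorem proj_sub (f : Fin m → MvPolynomial σ K) (α β : FreeMod σ K m) :
    proj f (α - β) = proj f α - proj f β := by
  simp [proj, sub_mul]

theorem proj_basisVec (f : Fin m → MvPolynomial σ K) (i : Fin m) :
    proj f (basisVec σ K i) = f i := by
  simp [proj, basisVec, Pi.single_apply]

theorem proj_koszul (f : Fin m → MvPolynomial σ K) (α β : FreeMod σ K m) :
    proj f (koszul f α β) = 0 := by
  rw [koszul, proj_sub, proj_smul, proj_smul, mul_comm, sub_self]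

theorem proj_zero (f : Fin m → MvPolynomial σ K) : proj f (0 : FreeMod σ K m) = 0 := by
  simp [proj]

/-! ### Signatures -/

section Signature

variable {mo : MonomialOrder σ} {α β : FreeMod σ K m}

theorem sig_le_iff {T : WithBot (ModMon mo m)} :
    sig mo α ≤ T ↔ ∀ i, ∀ d ∈ (α i).support,
      ((toLex (i, mo.toSyn d) : ModMon mo m) : WithBot (ModMon mo m)) ≤ T := by
  simp only [sig, Finset.sup_le_iff, Finset.mem_univ, true_imp_iff]

theorem sig_lt_iff {T : WithBot (ModMon mo m)} (hT : ⊥ < T) :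
    sig mo α < T ↔ ∀ i, ∀ d ∈ (α i).support,
      ((toLex (i, mo.toSyn d) : ModMon mo m) : WithBot (ModMon mo m)) < T := by
  simp only [sig, Finset.sup_lt_iff hT, Finset.mem_univ, true_imp_iff]

theorem le_sig {i : Fin m} {d : σ →₀ ℕ} (hd : d ∈ (α i).support) :
    ((toLex (i, mo.toSyn d) : ModMon mo m) : WithBot (ModMon mo m)) ≤ sig mo α :=
  sig_le_iff.mp le_rfl i d hd

/-- The supremum is attained: without the monomial at `(i, d)`, every monomial of `α` would lie
strictly below it. -/
theorem coeff_ne_zero_of_sig_eq {i : Fin m} {d : σ →₀ ℕ}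
    (h : sig mo α = ((toLex (i, mo.toSyn d) : ModMon mo m) : WithBot (ModMon mo m))) :
    coeff d (α i) ≠ 0 := by
  intro h0
  refine lt_irrefl (sig mo α) ?_
  nth_rewrite 2 [h]
  refine (sig_lt_iff (WithBot.bot_lt_coe _)).mpr fun j e he => ?_
  refine lt_of_le_of_ne (h ▸ le_sig he) fun heq => ?_
  have heq' := congrArg ofLex (WithBot.coe_injective heq)
  simp only [ofLex_toLex, Prod.mk.injEq, EmbeddingLike.apply_eq_iff_eq] at heq'
  obtain ⟨rfl, rfl⟩ := heq'
  exact (mem_support_iff.mp he) h0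

theorem coe_toLex_le {i j : Fin m} {s t : mo.syn} :
    ((toLex (i, s) : ModMon mo m) : WithBot (ModMon mo m)) ≤ (toLex (j, t) : ModMon mo m) ↔
      i < j ∨ i = j ∧ s ≤ t := by
  rw [WithBot.coe_le_coe, Prod.Lex.toLex_le_toLex]

/-- Position over term: the last nonzero component decides, and within it the leading exponent. -/
theorem sig_eq_coe_iff {i : Fin m} {s : mo.syn} :
    sig mo α = ((toLex (i, s) : ModMon mo m) : WithBot (ModMon mo m)) ↔
      α i ≠ 0 ∧ mo.toSyn (mo.degree (α i)) = s ∧ ∀ j, i < j → α j = 0 := by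
  constructor
  · intro h
    obtain ⟨d, rfl⟩ := mo.toSyn.surjective s
    have hc := coeff_ne_zero_of_sig_eq h
    have hi : α i ≠ 0 := fun h0 => hc (by simp [h0])
    refine ⟨hi, le_antisymm ?_ (mo.le_degree (mem_support_iff.mpr hc)), fun j hj => ?_⟩
    · have := h ▸ le_sig (mo := mo) (mo.degree_mem_support hi)
      rw [coe_toLex_le] at this
      simpa using this
    · by_contra hne
      have := h ▸ le_sig (mo := mo) (mo.degree_mem_support hne)
      rw [coe_toLex_le] at this
      rcases this with h' | ⟨h', -⟩
      · exact absurd h' hj.asymm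
      · exact hj.ne h'.symm
  · rintro ⟨hi, rfl, hj⟩
    refine le_antisymm (sig_le_iff.mpr fun j d hd => ?_) (le_sig (mo.degree_mem_support hi))
    rw [coe_toLex_le]
    rcases lt_trichotomy j i with h | rfl | h
    · exact Or.inl h
    · exact Or.inr ⟨rfl, mo.le_degree hd⟩
    · simp [hj j h] at hd

theorem sig_eq_bot_iff : sig mo α = ⊥ ↔ α = 0 := by
  rw [← le_bot_iff, sig_le_iff]
  simp only [le_bot_iff, WithBot.coe_ne_bot, imp_false]
  constructor
  · intro h
    funext i
    exact support_eq_empty.mp (Finset.eq_empty_of_forall_notMem (h i))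
  · rintro rfl
    simp

theorem sig_basisVec (i : Fin m) :
    sig mo (basisVec σ K i) = ((toLex (i, 0) : ModMon mo m) : WithBot (ModMon mo m)) := by
  rw [sig_eq_coe_iff]
  refine ⟨by simp [basisVec], by simp [basisVec], fun j hj => by simp [basisVec, hj.ne']⟩

theorem syn_nonneg (s : mo.syn) : 0 ≤ s := by
  obtain ⟨d, rfl⟩ := mo.toSyn.surjective s
  rw [← map_zero mo.toSyn]
  exact mo.toSyn_monotone zero_le

/-- `e_i` is the least module monomial in position `i`. This translates a bound on signatures into
membership in the span of the earlier unit vectors. -/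
theorem sig_lt_sig_basisVec_iff {i : Fin m} :
    sig mo α < sig mo (basisVec σ K i) ↔ ∀ j, i ≤ j → α j = 0 := by
  rw [sig_basisVec, sig_lt_iff (WithBot.bot_lt_coe _)]
  constructor
  · intro h j hj
    by_contra hne
    have := h j _ (mo.degree_mem_support hne)
    rw [← not_le, coe_toLex_le] at this
    refine this ?_
    rcases hj.lt_or_eq with h' | h'
    · exact Or.inl h'
    · exact Or.inr ⟨h', syn_nonneg _⟩
  · intro h j d hd
    rw [← not_le, coe_toLex_le]
    intro h'
    have : i ≤ j := by
      rcases h' with h' | ⟨h', -⟩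
      exacts [h'.le, h'.le]
    simp [h j this] at hd

theorem sig_neg : sig mo (-α) = sig mo α := by
  simp only [sig, Pi.neg_apply, support_neg]

theorem sig_add_le : sig mo (α + β) ≤ sig mo α ⊔ sig mo β := by
  classical
  refine sig_le_iff.mpr fun i d hd => ?_
  rcases Finset.mem_union.mp (support_add hd) with h | h
  · exact (le_sig h).trans le_sup_left
  · exact (le_sig h).trans le_sup_right

theorem sig_sub_le : sig mo (α - β) ≤ sig mo α ⊔ sig mo β := by
  simpa only [sub_eq_add_neg, sig_neg] using sig_add_le (mo := mo) (α := α) (β := -β)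

theorem sig_sub_comm : sig mo (α - β) = sig mo (β - α) := by
  rw [← neg_sub, sig_neg]

theorem sig_sub_of_lt (h : sig mo β < sig mo α) : sig mo (α - β) = sig mo α := by
  refine le_antisymm (sig_sub_le.trans (sup_le le_rfl h.le)) (not_lt.mp fun hlt => ?_)
  have h1 : sig mo ((α - β) + β) < sig mo α := sig_add_le.trans_lt (sup_lt_iff.mpr ⟨hlt, h⟩)
  rw [sub_add_cancel] at h1
  exact lt_irrefl _ h1

theorem sig_C_smul {c : K} (hc : c ≠ 0) :
    sig mo ((C c : MvPolynomial σ K) • α) = sig mo α := by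
  have : ∀ i, ((((C c : MvPolynomial σ K) • α) i)).support = (α i).support := fun i => by
    ext d
    simp [hc]
  simp only [sig, this]

theorem sig_monomial_smul_of_ne_zero {c : K} (hc : c ≠ 0) (d : σ →₀ ℕ) :
    sig mo ((monomial d c : MvPolynomial σ K) • α) = (sig mo α).map (shift mo d) := by
  rw [← mul_one c, ← C_mul_monomial, mul_smul, sig_C_smul hc, sig_monomial_smul]

theorem exists_sig_sub_smul_lt (h : sig mo α = sig mo β) (hα : α ≠ 0) :
    ∃ c : K, c ≠ 0 ∧ sig mo (α - (C c : MvPolynomial σ K) • β) < sig mo α := by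
  obtain ⟨p, hp⟩ := WithBot.ne_bot_iff_exists.mp (mt sig_eq_bot_iff.mp hα)
  obtain ⟨⟨i, s⟩, rfl⟩ := toLex.surjective p
  obtain ⟨d, rfl⟩ := mo.toSyn.surjective s
  have ha := coeff_ne_zero_of_sig_eq hp.symm
  have hb := coeff_ne_zero_of_sig_eq (h ▸ hp).symm
  have hc := div_ne_zero ha hb
  -- The scalar is the quotient of the two coefficients at the common signature; these then cancel.
  refine ⟨_, hc, lt_of_le_of_ne ?_ fun heq => ?_⟩
  · refine sig_sub_le.trans ?_
    rw [sig_C_smul hc, h, sup_idem]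
  · refine coeff_ne_zero_of_sig_eq (heq.trans hp.symm) ?_
    simp [hb]

theorem sigDvd_iff {T : WithBot (ModMon mo m)} :
    SigDvd mo α T ↔ ∃ c : σ →₀ ℕ, (sig mo α).map (shift mo c) = T := by
  simp only [SigDvd, sig_monomial_smul]

theorem SigDvd.map_shift {T : WithBot (ModMon mo m)} (h : SigDvd mo α T) (c : σ →₀ ℕ) :
    SigDvd mo α (T.map (shift mo c)) := by
  rw [sigDvd_iff] at *
  obtain ⟨d, rfl⟩ := h
  exact ⟨d + c, (shift_shift mo d c _).symm⟩

theorem SigDvd.of_sig_eq {T : WithBot (ModMon mo m)} (h : sig mo α = T) : SigDvd mo α T :=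
  ⟨0, by simpa using h⟩

theorem SigDvd.trans {T : WithBot (ModMon mo m)} (h : SigDvd mo α (sig mo β))
    (h' : SigDvd mo β T) : SigDvd mo α T := by
  obtain ⟨c, rfl⟩ := sigDvd_iff.mp h'
  exact h.map_shift c

theorem le_map_shift (c : σ →₀ ℕ) (T : WithBot (ModMon mo m)) : T ≤ T.map (shift mo c) := by
  cases T with
  | bot => exact bot_le
  | coe p =>
    obtain ⟨⟨i, s⟩, rfl⟩ := toLex.surjective p
    rw [WithBot.map_coe]
    exact coe_toLex_le.mpr (Or.inr ⟨rfl, le_add_of_nonneg_left (syn_nonneg _)⟩)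

theorem SigDvd.sig_le {T : WithBot (ModMon mo m)} (h : SigDvd mo α T) : sig mo α ≤ T := by
  obtain ⟨c, rfl⟩ := sigDvd_iff.mp h
  exact le_map_shift c _

/-- As `α` vanishes from position `i` on, only `proj f α • e_i` contributes there. -/
theorem sig_koszul_basisVec (f : Fin m → MvPolynomial σ K) {i : Fin m}
    (h : sig mo α < sig mo (basisVec σ K i)) (hα : proj f α ≠ 0) :
    sig mo (koszul f (basisVec σ K i) α) =
      ((toLex (i, mo.toSyn (mo.degree (proj f α))) : ModMon mo m) : WithBot (ModMon mo m)) := by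
  rw [sig_lt_sig_basisVec_iff] at h
  have hi : koszul f (basisVec σ K i) α i = proj f α := by
    simp [koszul, basisVec, h i le_rfl]
  rw [sig_eq_coe_iff, hi]
  refine ⟨hα, rfl, fun j hj => ?_⟩
  simp [koszul, basisVec, h j hj.le, hj.ne']

end Signature

/-! ### S-pairs and regular s-reduction -/

section Reduction

variable {mo : MonomialOrder σ} {f : Fin m → MvPolynomial σ K} {α β γ : FreeMod σ K m}

theorem sig_spairPart (hα : proj f α ≠ 0) :
    sig mo (spairPart mo f α β) = (sig mo α).map (shift mo (cofactor mo f α β)) :=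
  sig_monomial_smul_of_ne_zero (inv_ne_zero (mo.leadingCoeff_ne_zero_iff.mpr hα)) _

theorem sig_spair_comm : sig mo (spair mo f α β) = sig mo (spair mo f β α) :=
  sig_sub_comm

theorem sig_spair_of_lt (h : sig mo (spairPart mo f β α) < sig mo (spairPart mo f α β)) :
    sig mo (spair mo f α β) = sig mo (spairPart mo f α β) :=
  sig_sub_of_lt h

theorem RegularSPair.symm (h : RegularSPair mo f α β) : RegularSPair mo f β α :=
  Ne.symm h

theorem RegularSPair.sig_spair_eq_or (h : RegularSPair mo f α β) :
    sig mo (spair mo f α β) = sig mo (spairPart mo f α β) ∨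
      sig mo (spair mo f α β) = sig mo (spairPart mo f β α) := by
  rcases lt_or_gt_of_ne h with h | h
  · exact Or.inr (sig_spair_comm.trans (sig_spair_of_lt h))
  · exact Or.inl (sig_spair_of_lt h)

theorem cofactor_add_degree :
    cofactor mo f α β + mo.degree (proj f α) = mo.degree (proj f α) ⊔ mo.degree (proj f β) :=
  tsub_add_cancel_of_le le_sup_left

theorem degree_proj_monomial_smul_of_ne_zero {c : K} (hc : c ≠ 0) (d : σ →₀ ℕ)
    (hα : proj f α ≠ 0) :
    mo.degree (proj f ((monomial d c : MvPolynomial σ K) • α)) = d + mo.degree (proj f α) := by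
  classical
  rw [proj_smul, mo.degree_mul (by simpa using hc) hα, mo.degree_monomial, if_neg hc]

theorem degree_proj_spairPart (hα : proj f α ≠ 0) :
    mo.degree (proj f (spairPart mo f α β)) = mo.degree (proj f α) ⊔ mo.degree (proj f β) := by
  rw [spairPart, degree_proj_monomial_smul_of_ne_zero
    (inv_ne_zero (mo.leadingCoeff_ne_zero_iff.mpr hα)) _ hα, cofactor_add_degree]

theorem leadingCoeff_proj_spairPart (hα : proj f α ≠ 0) :
    mo.leadingCoeff (proj f (spairPart mo f α β)) = 1 := by
  rw [spairPart, proj_smul, mo.leadingCoeff_mul, mo.leadingCoeff_monomial,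
    inv_mul_cancel₀ (mo.leadingCoeff_ne_zero_iff.mpr hα)]

/-- Both parts have monic images with the least common multiple as lead exponent, so the lead terms
cancel. -/
theorem lt_of_mem_support_proj_spair (hα : proj f α ≠ 0) (hβ : proj f β ≠ 0) {d : σ →₀ ℕ}
    (hd : d ∈ (proj f (spair mo f α β)).support) :
    mo.toSyn d < mo.toSyn (mo.degree (proj f α) ⊔ mo.degree (proj f β)) := by
  classical
  have h1 := degree_proj_spairPart (mo := mo) (β := β) hα
  have h2 := degree_proj_spairPart (mo := mo) (β := α) hβ
  rw [sup_comm] at h2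
  rw [spair, proj_sub] at hd
  refine lt_of_le_of_ne ?_ fun heq => ?_
  · rcases Finset.mem_union.mp (support_sub σ _ _ hd) with h | h
    · exact h1 ▸ mo.le_degree h
    · exact h2 ▸ mo.le_degree h
  · rw [EmbeddingLike.apply_eq_iff_eq] at heq
    refine mem_support_iff.mp hd ?_
    have c1 := leadingCoeff_proj_spairPart (mo := mo) (β := β) hα
    have c2 := leadingCoeff_proj_spairPart (mo := mo) (β := α) hβ
    rw [MonomialOrder.leadingCoeff, h1, ← heq] at c1
    rw [MonomialOrder.leadingCoeff, h2, ← heq] at c2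
    rw [coeff_sub, c1, c2, sub_self]

theorem RegularSRedStep.sig_eq {G : List (FreeMod σ K m)} (h : RegularSRedStep mo f G α β) :
    sig mo β = sig mo α := by
  obtain ⟨δ, -, d, c, e, -, -, hs, rfl⟩ := h
  exact sig_sub_of_lt hs

/-- The subtracted multiple has its lead exponent in the support of the image of `α`, so no exponent
reaches the bound, even if the reduced term is not the lead term. -/
theorem RegularSRedStep.support_lt {G : List (FreeMod σ K m)} (h : RegularSRedStep mo f G α β)
    {s : mo.syn} (hs : ∀ d ∈ (proj f α).support, mo.toSyn d < s) :
    ∀ d ∈ (proj f β).support, mo.toSyn d < s := by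
  classical
  obtain ⟨δ, -, d, c, e, he, hl, -, rfl⟩ := h
  intro d' hd'
  rw [proj_sub] at hd'
  rcases Finset.mem_union.mp (support_sub σ _ _ hd') with h | h
  · exact hs _ h
  · refine (mo.le_degree h).trans_lt ?_
    rw [← mo.degree_leadingTerm, hl, mo.degree_monomial, if_neg (mem_support_iff.mp he)]
    exact hs _ he

theorem RegularSReduces.sig_eq {G : List (FreeMod σ K m)} (h : RegularSReduces mo f G α β) :
    sig mo β = sig mo α := by
  obtain ⟨h, -⟩ := h
  induction h with
  | refl => rfl
  | tail _ h ih => exact h.sig_eq.trans ih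

theorem RegularSReduces.degree_lt {G : List (FreeMod σ K m)} (h : RegularSReduces mo f G α β)
    {s : mo.syn} (hs : ∀ d ∈ (proj f α).support, mo.toSyn d < s) (hβ : proj f β ≠ 0) :
    mo.toSyn (mo.degree (proj f β)) < s := by
  obtain ⟨h, -⟩ := h
  suffices ∀ d ∈ (proj f β).support, mo.toSyn d < s from this _ (mo.degree_mem_support hβ)
  clear hβ
  induction h with
  | refl => exact hs
  | tail _ h ih => exact h.support_lt ih

end Reduction

/-! ### Rewritability and the invariant of the main loop -/

section Rewriting

variable {mo : MonomialOrder σ} {f : Fin m → MvPolynomial σ K}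
  {lt : Entry σ K m → Entry σ K m → Prop} {G G' : List (FreeMod σ K m)}
  {H H' : Set (FreeMod σ K m)} {x y : Entry σ K m}

theorem IsEntry.mem (h : IsEntry G x) : x.2 ∈ G :=
  List.mem_of_getElem? h

theorem IsEntry.fst_lt (h : IsEntry G x) : x.1 < G.length :=
  (List.getElem?_eq_some_iff.mp h).1

/-- A prefix rather than an inclusion: entries carry their positions, which appending preserves. -/
theorem IsEntry.mono (h : IsEntry G x) (hG : G <+: G') : IsEntry G' x := by
  obtain ⟨L, rfl⟩ := hG
  rw [IsEntry, List.getElem?_append_left h.fst_lt]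
  exact h

theorem IsEntry.snd_eq (hx : IsEntry G x) (hy : IsEntry G y) (h : x.1 = y.1) : x.2 = y.2 := by
  rw [IsEntry] at hx hy
  rw [h, hy] at hx
  exact (Option.some.inj hx).symm

theorem exists_isEntry_of_mem {α : FreeMod σ K m} (h : α ∈ G) : ∃ n, IsEntry G (n, α) :=
  List.mem_iff_getElem?.mp h

theorem isEntry_append_singleton {γ : FreeMod σ K m} :
    IsEntry (G ++ [γ]) x ↔ IsEntry G x ∨ x = (G.length, γ) := by
  constructor
  · intro h
    have hlt := h.fst_lt
    rw [List.length_append, List.length_singleton, Nat.lt_succ_iff] at hlt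
    rcases hlt.lt_or_eq with h' | h'
    · left
      rwa [IsEntry, List.getElem?_append_left h'] at h
    · right
      rw [IsEntry, h', List.getElem?_concat_length] at h
      exact Prod.ext h' (Option.some.inj h).symm
  · rintro (h | rfl)
    · exact h.mono (List.prefix_append _ _)
    · simp [IsEntry]

theorem MulRewritable.mono {T : WithBot (ModMon mo m)} (h : MulRewritable mo lt G H x T)
    (hG : G <+: G') (hH : H ⊆ H') : MulRewritable mo lt G' H' x T := by
  rcases h with ⟨h, hh, hd⟩ | ⟨y, hy, hd⟩
  · exact Or.inl ⟨h, hH hh, hd⟩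
  · exact Or.inr ⟨y, hy.mono hG, hd⟩

theorem MulRewritable.map_shift {T : WithBot (ModMon mo m)} (h : MulRewritable mo lt G H x T)
    (c : σ →₀ ℕ) : MulRewritable mo lt G H x (T.map (shift mo c)) := by
  rcases h with ⟨h, hh, hd⟩ | ⟨y, hy, hl, hd⟩
  · exact Or.inl ⟨h, hh, hd.map_shift c⟩
  · exact Or.inr ⟨y, hy, hl, hd.map_shift c⟩

/-- The S-pair of `x` and `y` has been treated: it is rewritable, or its signature is that of a
known syzygy or of a later basis element with lead term below the common multiple. -/
def PairDone (mo : MonomialOrder σ) (f : Fin m → MvPolynomial σ K)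
    (lt : Entry σ K m → Entry σ K m → Prop) (G : List (FreeMod σ K m))
    (H : Set (FreeMod σ K m)) (x y : Entry σ K m) : Prop :=
  (MulRewritable mo lt G H x (sig mo (spairPart mo f x.2 y.2)) ∨
      MulRewritable mo lt G H y (sig mo (spairPart mo f y.2 x.2))) ∨
    (∃ h ∈ H, sig mo h = sig mo (spair mo f x.2 y.2)) ∨
    ∃ z, IsEntry G z ∧ x.1 < z.1 ∧ y.1 < z.1 ∧ sig mo z.2 = sig mo (spair mo f x.2 y.2) ∧
      mo.toSyn (mo.degree (proj f z.2)) <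
        mo.toSyn (mo.degree (proj f x.2) ⊔ mo.degree (proj f y.2))

theorem PairDone.mono (h : PairDone mo f lt G H x y) (hG : G <+: G') (hH : H ⊆ H') :
    PairDone mo f lt G' H' x y := by
  rcases h with (h | h) | ⟨h, hh, hs⟩ | ⟨z, hz, h⟩
  · exact Or.inl (Or.inl (h.mono hG hH))
  · exact Or.inl (Or.inr (h.mono hG hH))
  · exact Or.inr (Or.inl ⟨h, hH hh, hs⟩)
  · exact Or.inr (Or.inr ⟨z, hz.mono hG, h⟩)

theorem PairDone.symm (h : PairDone mo f lt G H x y) : PairDone mo f lt G H y x := by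
  rcases h with h | ⟨h, hh, hs⟩ | ⟨z, hz, hx, hy, hs, hd⟩
  · exact Or.inl h.symm
  · exact Or.inr (Or.inl ⟨h, hh, hs.trans sig_spair_comm⟩)
  · exact Or.inr (Or.inr ⟨z, hz, hy, hx, hs.trans sig_spair_comm, by rwa [sup_comm]⟩)

/-- The unit vector `e_i` has been treated. -/
def UnitDone (mo : MonomialOrder σ) (G : List (FreeMod σ K m)) (H : Set (FreeMod σ K m))
    (i : Fin m) : Prop :=
  (∃ h ∈ H, SigDvd mo h (sig mo (basisVec σ K i))) ∨
    ∃ g ∈ G, sig mo g = sig mo (basisVec σ K i)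

theorem UnitDone.mono {i : Fin m} (h : UnitDone mo G H i) (hG : G <+: G') (hH : H ⊆ H') :
    UnitDone mo G' H' i := by
  rcases h with ⟨h, hh, hd⟩ | ⟨g, hg, hs⟩
  · exact Or.inl ⟨h, hH hh, hd⟩
  · exact Or.inr ⟨g, hG.subset hg, hs⟩

/-- Every signature `lt(α̅) e_i` with `𝔰(α) < e_i` and `α̅ ≠ 0` is divisible by the signature of
a known syzygy. -/
def KoszulDone (mo : MonomialOrder σ) (f : Fin m → MvPolynomial σ K)
    (H : Set (FreeMod σ K m)) (i : Fin m) : Prop :=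
  ∀ α : FreeMod σ K m, sig mo α < sig mo (basisVec σ K i) → proj f α ≠ 0 →
    ∃ h ∈ H, SigDvd mo h
      ((toLex (i, mo.toSyn (mo.degree (proj f α))) : ModMon mo m) : WithBot (ModMon mo m))

theorem KoszulDone.mono {i : Fin m} (h : KoszulDone mo f H i) (hH : H ⊆ H') :
    KoszulDone mo f H' i := fun α h1 h2 =>
  let ⟨k, hk, hd⟩ := h α h1 h2
  ⟨k, hH hk, hd⟩

/-- The properties of the states of RB that make the algorithm correct. -/
structure Invariant (mo : MonomialOrder σ) (f : Fin m → MvPolynomial σ K)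
    (lt : Entry σ K m → Entry σ K m → Prop) (S : State σ K m) : Prop where
  proj_ne_zero : ∀ g ∈ S.G, proj f g ≠ 0
  proj_eq_zero : ∀ h ∈ S.H, proj f h = 0
  unit_done : ∀ i, .unit i ∉ S.P → UnitDone mo S.G S.H i
  pair_mem : ∀ x y, .pair x y ∈ S.P →
    IsEntry S.G x ∧ IsEntry S.G y ∧ x.1 < y.1 ∧ RegularSPair mo f x.2 y.2
  pair_done : ∀ x y, IsEntry S.G x → IsEntry S.G y → x.1 < y.1 → RegularSPair mo f x.2 y.2 →
    .pair x y ∉ S.P → PairDone mo f lt S.G S.H x y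
  unit_notMem : ∀ g ∈ S.G, ∀ i s,
    sig mo g = ((toLex (i, s) : ModMon mo m) : WithBot (ModMon mo m)) → .unit i ∉ S.P
  koszul_done : ∀ i, .unit i ∉ S.P → KoszulDone mo f S.H i

end Rewriting

/-! ### Signature Gröbner bases below the pending signatures -/

section Groebner

variable {mo : MonomialOrder σ} {f : Fin m → MvPolynomial σ K}
  {lt : Entry σ K m → Entry σ K m → Prop} {S : State σ K m}

/-- Among the basis elements whose signature divides `T` there is one that no other such
element exceeds in the rewrite order. -/
theorem exists_maximal_entry (hlt : IsRewriteOrder mo f lt) (hS : Invariant mo f lt S)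
    {T : WithBot (ModMon mo m)} (hT : ∃ g ∈ S.G, SigDvd mo g T) :
    ∃ y, IsEntry S.G y ∧ SigDvd mo y.2 T ∧
      ∀ z, IsEntry S.G z → lt y z → ¬ SigDvd mo z.2 T := by
  let E := {y : Entry σ K m // IsEntry S.G y}
  have hE : Finite E :=
    Finite.of_injective (fun y : E => (⟨y.1.1, y.2.fst_lt⟩ : Fin S.G.length)) fun y z h =>
      Subtype.ext (Prod.ext (Fin.mk.inj h) (y.2.snd_eq z.2 (Fin.mk.inj h)))
  have hp : ∀ y : E, proj f y.1.2 ≠ 0 := fun y => hS.proj_ne_zero _ y.2.mem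
  -- The rewrite order reversed: a minimal element for `r` is a maximal entry, and finiteness of `E`
  -- makes `r` well-founded.
  let r : E → E → Prop := fun y z => lt z.1 y.1
  have : IsTrans E r := ⟨fun x y z h k => hlt.trans _ _ _ (hp z) (hp y) (hp x) k h⟩
  have : Std.Irrefl r := ⟨fun x => hlt.irrefl _ (hp x)⟩
  obtain ⟨g, hg, hd⟩ := hT
  obtain ⟨n, hn⟩ := exists_isEntry_of_mem hg
  obtain ⟨y, hy, hmin⟩ := (Finite.wellFounded_of_trans_of_irrefl r).has_min
    {y : E | SigDvd mo y.1.2 T} ⟨⟨_, hn⟩, hd⟩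
  exact ⟨y.1, y.2, hy, fun z hz hl hd => hmin ⟨z, hz⟩ hd hl⟩

/-- A regular S-pair with signature below `T₀` cannot be pending. Pairs are stored only with the
earlier entry first, hence the case split on positions. -/
theorem Invariant.pairDone (hS : Invariant mo f lt S) {T₀ : WithBot (ModMon mo m)}
    (hP : ∀ q ∈ S.P, T₀ ≤ sig mo (q.elem mo f)) {x y : Entry σ K m} (hx : IsEntry S.G x)
    (hy : IsEntry S.G y)
    (hlt : sig mo (spairPart mo f y.2 x.2) < sig mo (spairPart mo f x.2 y.2))
    (hT : sig mo (spairPart mo f x.2 y.2) < T₀) : PairDone mo f lt S.G S.H x y := by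
  have hr : RegularSPair mo f x.2 y.2 := hlt.ne'
  have hs := sig_spair_of_lt hlt
  rcases lt_trichotomy x.1 y.1 with h | h | h
  · exact hS.pair_done x y hx hy h hr fun hm => ((hP _ hm).trans_eq hs).not_gt hT
  · rw [hx.snd_eq hy h] at hlt
    exact absurd hlt (lt_irrefl _)
  · exact (hS.pair_done y x hy hx h hr.symm fun hm =>
      ((hP _ hm).trans_eq (sig_spair_comm.trans hs)).not_gt hT).symm

theorem map_shift_lt_iff {c : σ →₀ ℕ} {T T' : WithBot (ModMon mo m)} :
    T.map (shift mo c) < T'.map (shift mo c) ↔ T < T' :=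
  (map_shift_strictMono mo c).lt_iff_lt

/-- If a multiple of `y` below `T₀` is not rewritable, then every regular top reducer of it is. -/
theorem Invariant.mulRewritable_of_regular_reducer (hlt : IsRewriteOrder mo f lt)
    (hS : Invariant mo f lt S)
    {T₀ : WithBot (ModMon mo m)} (hP : ∀ q ∈ S.P, T₀ ≤ sig mo (q.elem mo f))
    {y g : Entry σ K m} (hy : IsEntry S.G y) (hg : IsEntry S.G g) {a b : σ →₀ ℕ}
    (hab : a + mo.degree (proj f y.2) = b + mo.degree (proj f g.2))
    (hsig : (sig mo g.2).map (shift mo b) < (sig mo y.2).map (shift mo a))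
    (hT : (sig mo y.2).map (shift mo a) < T₀)
    (hyT : ¬ MulRewritable mo lt S.G S.H y ((sig mo y.2).map (shift mo a))) :
    MulRewritable mo lt S.G S.H g ((sig mo g.2).map (shift mo b)) := by
  have hpy := hS.proj_ne_zero _ hy.mem
  have hpg := hS.proj_ne_zero _ hg.mem
  -- The common lead exponent is a multiple of the least common multiple, so both given multiples
  -- are `x^c` times the parts of the S-pair, up to scalars.
  obtain ⟨c, hc⟩ : ∃ c, a + mo.degree (proj f y.2) =
      (mo.degree (proj f y.2) ⊔ mo.degree (proj f g.2)) + c :=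
    exists_add_of_le (sup_le le_add_self (hab ▸ le_add_self))
  have ha : a = cofactor mo f y.2 g.2 + c := by
    refine add_right_cancel (b := mo.degree (proj f y.2)) ?_
    rw [hc, ← cofactor_add_degree, add_right_comm]
  have hb : b = cofactor mo f g.2 y.2 + c := by
    refine add_right_cancel (b := mo.degree (proj f g.2)) ?_
    rw [← hab, hc, sup_comm, ← cofactor_add_degree, add_right_comm]
  have hsy : ((sig mo (spairPart mo f y.2 g.2)).map (shift mo c)) =
      (sig mo y.2).map (shift mo a) := by
    rw [sig_spairPart hpy, shift_shift, ← ha]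
  have hsg : ((sig mo (spairPart mo f g.2 y.2)).map (shift mo c)) =
      (sig mo g.2).map (shift mo b) := by
    rw [sig_spairPart hpg, shift_shift, ← hb]
  rw [← hsy] at hsig hT hyT
  rw [← hsg] at hsig ⊢
  have hlt' := map_shift_lt_iff.mp hsig
  have hs := sig_spair_of_lt hlt'
  rcases hS.pairDone hP hy hg hlt' ((le_map_shift c _).trans_lt hT) with
    (h | h) | ⟨h, hh, hs'⟩ | ⟨z, hz, hyz, -, hs', hd⟩
  · exact absurd (h.map_shift c) hyT
  · exact h.map_shift c
  · exact absurd (Or.inl ⟨h, hh, (SigDvd.of_sig_eq (hs'.trans hs)).map_shift c⟩) hyT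
  -- The S-pair was reduced to the later element `z`, whose lead term is below that of the `y` part;
  -- admissibility ranks `z` above `y`.
  · refine absurd (Or.inr ⟨z, hz, ?_, (SigDvd.of_sig_eq (hs'.trans hs)).map_shift c⟩) hyT
    refine hlt.admissible y z hpy (hS.proj_ne_zero _ hz.mem) hyz (cofactor mo f y.2 g.2) ?_ ?_
    · rw [hs', hs, sig_spairPart hpy, sig_monomial_smul]
    · rwa [degree_proj_monomial_smul mo f _ _ hpy, cofactor_add_degree]

/-- If all items of the pair set have signature at least `T₀`, then the basis is a signature
Gröbner basis below `T₀`, with reducers that are not rewritable. -/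
theorem Invariant.exists_reducer (hlt : IsRewriteOrder mo f lt) (hS : Invariant mo f lt S)
    {T₀ : WithBot (ModMon mo m)} (hP : ∀ q ∈ S.P, T₀ ≤ sig mo (q.elem mo f))
    (T : WithBot (ModMon mo m)) (hT : T < T₀) (α : FreeMod σ K m) (hα : sig mo α = T)
    (hpα : proj f α ≠ 0) :
    ∃ y a, IsEntry S.G y ∧ a + mo.degree (proj f y.2) = mo.degree (proj f α) ∧
      (sig mo y.2).map (shift mo a) ≤ T ∧
      ¬ MulRewritable mo lt S.G S.H y ((sig mo y.2).map (shift mo a)) := by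
  induction T using WellFoundedLT.induction generalizing α with
  | ind T ih =>
  have hα0 : α ≠ 0 := by
    rintro rfl
    exact hpα (proj_zero f)
  have below : ∀ β, sig mo β < T → proj f β ≠ 0 →
      ∃ y a, IsEntry S.G y ∧ a + mo.degree (proj f y.2) = mo.degree (proj f β) ∧
        (sig mo y.2).map (shift mo a) < T ∧
        ¬ MulRewritable mo lt S.G S.H y ((sig mo y.2).map (shift mo a)) := by
    intro β hβ hpβ
    obtain ⟨y, a, h1, h2, h3, h4⟩ := ih _ hβ (hβ.trans hT) β rfl hpβ
    exact ⟨y, a, h1, h2, h3.trans_lt hβ, h4⟩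
  -- Subtracting a multiple of a syzygy lowers the signature and keeps the image, so induction
  -- applies.
  by_cases hsyz : ∃ h ∈ S.H, SigDvd mo h T
  · obtain ⟨h, hh, c, hc⟩ := hsyz
    obtain ⟨k, -, hk⟩ := exists_sig_sub_smul_lt (hα.trans hc.symm) hα0
    rw [hα] at hk
    have hp : proj f (α - (C k : MvPolynomial σ K) • (monomial c (1 : K)) • h) = proj f α := by
      rw [proj_sub, proj_smul, proj_smul, hS.proj_eq_zero h hh, mul_zero, mul_zero, sub_zero]
    obtain ⟨y, a, h1, h2, h3, h4⟩ := below _ hk (hp ▸ hpα)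
    exact ⟨y, a, h1, hp ▸ h2, h3.le, h4⟩
  obtain ⟨q, hp⟩ := WithBot.ne_bot_iff_exists.mp (hα ▸ mt sig_eq_bot_iff.mp hα0)
  obtain ⟨⟨i, s⟩, rfl⟩ := toLex.surjective q
  have hei : SigDvd mo (basisVec σ K i) T := by
    rw [sigDvd_iff, sig_basisVec, ← hp]
    refine ⟨mo.toSyn.symm s, ?_⟩
    rw [WithBot.map_coe]
    simp [shift]
  -- `e_i` divides `T`, so it lies below `T₀` and is no longer pending. Its treatment left a syzygy,
  -- excluded here, or a basis element with signature `e_i`.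
  have hunit : .unit i ∉ S.P := fun h => ((hP _ h).trans hei.sig_le).not_gt hT
  obtain ⟨y, hy, hyd, hmax⟩ := exists_maximal_entry hlt hS (T := T) <| by
    rcases hS.unit_done i hunit with ⟨h, hh, hd⟩ | ⟨g, hg, hs⟩
    · exact absurd ⟨h, hh, hd.trans hei⟩ hsyz
    · exact ⟨g, hg, (SigDvd.of_sig_eq hs).trans hei⟩
  obtain ⟨a, ha⟩ := sigDvd_iff.mp hyd
  have hyT : ¬ MulRewritable mo lt S.G S.H y ((sig mo y.2).map (shift mo a)) := by
    rw [ha]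
    rintro (h | ⟨z, hz, hl, hd⟩)
    exacts [hsyz h, hmax z hz hl hd]
  have hpy := hS.proj_ne_zero _ hy.mem
  -- `x^a y` has no regular top reducer: induction would supply one that is not rewritable, against
  -- the preceding lemma.
  have hirr : ∀ β, sig mo β < T → proj f β ≠ 0 →
      mo.degree (proj f β) ≠ a + mo.degree (proj f y.2) := by
    intro β hβ hpβ hd
    obtain ⟨g, b, h1, h2, h3, h4⟩ := below β hβ hpβ
    exact h4 (hS.mulRewritable_of_regular_reducer hlt hP hy h1 (hd.symm.trans h2.symm) (ha ▸ h3)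
      (ha ▸ hT) hyT)
  obtain ⟨k, hk0, hk⟩ := exists_sig_sub_smul_lt
    (hα.trans (ha.symm.trans (sig_monomial_smul mo a y.2).symm)) hα0
  rw [hα, smul_smul, C_mul_monomial, mul_one] at hk
  have hdy := degree_proj_monomial_smul_of_ne_zero (mo := mo) hk0 a hpy
  have hne : proj f ((monomial a k : MvPolynomial σ K) • y.2) ≠ 0 := by
    rw [proj_smul]
    exact mul_ne_zero (by simpa using hk0) hpy
  -- The difference of `α` and `k x^a y` has signature below `T`. A smaller lead term of `α` would
  -- give it the lead exponent of `x^a y`, contradicting `hirr`; for equal exponents `y` is the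
  -- reducer; otherwise the difference keeps the lead term of `α` and induction applies.
  rcases lt_trichotomy (mo.toSyn (mo.degree (proj f α)))
    (mo.toSyn (mo.degree (proj f ((monomial a k : MvPolynomial σ K) • y.2)))) with h | h | h
  · rw [sig_sub_comm] at hk
    have hd := mo.degree_sub_of_lt h
    rw [← proj_sub] at hd
    refine absurd (hd.trans hdy) (hirr _ hk fun h0 => ?_)
    rw [proj_sub, sub_eq_zero] at h0
    rw [h0] at h
    exact lt_irrefl _ h
  · exact ⟨y, a, hy, (hdy.symm.trans (mo.toSyn.injective h).symm), ha.le, hyT⟩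
  · have hd := mo.degree_sub_of_lt h
    rw [← proj_sub] at hd
    obtain ⟨z, b, h1, h2, h3, h4⟩ := below _ hk fun h0 => by
      rw [proj_sub, sub_eq_zero] at h0
      rw [h0] at h
      exact lt_irrefl _ h
    exact ⟨z, b, h1, h2.trans hd, h3.le, h4⟩

end Groebner

/-! ### Preservation of the invariant along a run -/

section Run

variable {mo : MonomialOrder σ} {f : Fin m → MvPolynomial σ K}
  {lt : Entry σ K m → Entry σ K m → Prop} {S : State σ K m}

theorem invariant_initState : Invariant mo f lt (initState f) where
  proj_ne_zero := by simp [initState]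
  proj_eq_zero := by
    rintro h ⟨i, j, -, rfl⟩
    rw [proj_sub, proj_smul, proj_smul, proj_basisVec, proj_basisVec, mul_comm, sub_self]
  unit_done := fun i hi => absurd ⟨i, rfl⟩ hi
  pair_mem := by simp [initState]
  pair_done := by simp [initState, IsEntry]
  unit_notMem := by simp [initState]
  koszul_done := fun i hi => absurd ⟨i, rfl⟩ hi

theorem State.subset_updH (p : Item σ K m) : S.H ⊆ S.updH f p := by
  cases p with
  | unit i => exact Set.subset_union_left
  | pair x y => exact subset_rfl

theorem Invariant.proj_updH (hS : Invariant mo f lt S) (p : Item σ K m) :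
    ∀ h ∈ S.updH f p, proj f h = 0 := by
  cases p with
  | unit i =>
    rintro h (hh | ⟨α, -, rfl⟩)
    exacts [hS.proj_eq_zero h hh, proj_koszul f _ _]
  | pair x y => exact hS.proj_eq_zero

/-- Minimality of `e_i` among pending items allows `exists_reducer` with `T₀ = 𝔰(e_i)`; the reducer
found lies below `e_i`, and its Koszul syzygy has just been added. -/
theorem Invariant.koszulDone_updH (hlt : IsRewriteOrder mo f lt) (hS : Invariant mo f lt S)
    {i : Fin m} (hp : MayPick mo f S (.unit i)) : KoszulDone mo f (S.updH f (.unit i)) i := by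
  intro α hα hpα
  obtain ⟨y, a, hy, ha, hs, -⟩ := hS.exists_reducer hlt hp.2 _ hα α rfl hpα
  have hys := ((le_map_shift a _).trans hs).trans_lt hα
  refine ⟨_, Or.inr ⟨y.2, hy.mem, rfl⟩, ?_⟩
  rw [sigDvd_iff, sig_koszul_basisVec f hys (hS.proj_ne_zero _ hy.mem)]
  refine ⟨a, ?_⟩
  rw [WithBot.map_coe, ← ha, map_add]
  rfl

/-- An item has been treated. -/
def ItemDone (mo : MonomialOrder σ) (f : Fin m → MvPolynomial σ K)
    (lt : Entry σ K m → Entry σ K m → Prop) (G : List (FreeMod σ K m))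
    (H : Set (FreeMod σ K m)) : Item σ K m → Prop
  | .unit i => UnitDone mo G H i
  | .pair x y => PairDone mo f lt G H x y

/-- The invariant is preserved when the item `p` is treated. -/
theorem Invariant.step (hlt : IsRewriteOrder mo f lt) (hS : Invariant mo f lt S)
    {p : Item σ K m} (hp : MayPick mo f S p) {S' : State σ K m} (hG : S.G <+: S'.G)
    (hH : S.updH f p ⊆ S'.H) (hP : S.P \ {p} ⊆ S'.P)
    (proj_ne_zero : ∀ g ∈ S'.G, proj f g ≠ 0) (proj_eq_zero : ∀ h ∈ S'.H, proj f h = 0)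
    (done : ItemDone mo f lt S'.G S'.H p)
    (pair_mem : ∀ x y, .pair x y ∈ S'.P →
      IsEntry S'.G x ∧ IsEntry S'.G y ∧ x.1 < y.1 ∧ RegularSPair mo f x.2 y.2)
    (pair_new : ∀ x y, IsEntry S'.G x → IsEntry S'.G y → x.1 < y.1 →
      RegularSPair mo f x.2 y.2 → .pair x y ∉ S'.P → IsEntry S.G x ∧ IsEntry S.G y)
    (unit_notMem : ∀ g ∈ S'.G, ∀ i s,
      sig mo g = ((toLex (i, s) : ModMon mo m) : WithBot (ModMon mo m)) → .unit i ∉ S'.P) :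
    Invariant mo f lt S' := by
  have hH' := (State.subset_updH p).trans hH
  have hmem : ∀ q, q ∉ S'.P → q ≠ p → q ∉ S.P := fun q hq hqp h => hq (hP ⟨h, hqp⟩)
  refine ⟨proj_ne_zero, proj_eq_zero, ?_, pair_mem, ?_, unit_notMem, ?_⟩
  · intro i hi
    by_cases h : Item.unit i = p
    · subst h
      exact done
    · exact (hS.unit_done i (hmem _ hi h)).mono hG hH'
  · intro x y hx hy hxy hr hn
    by_cases h : Item.pair x y = p
    · subst h
      exact done
    · obtain ⟨hx', hy'⟩ := pair_new x y hx hy hxy hr hn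
      exact (hS.pair_done x y hx' hy' hxy hr (hmem _ hn h)).mono hG hH'
  · intro i hi
    by_cases h : Item.unit i = p
    · subst h
      exact (hS.koszulDone_updH hlt hp).mono hH
    · exact (hS.koszul_done i (hmem _ hi h)).mono hH'

/-- The position of the signature of an item of the pair set is that of a unit vector or of a
basis element. -/
theorem Invariant.unit_notMem_of_sig_elem (hS : Invariant mo f lt S) {p : Item σ K m}
    (hp : p ∈ S.P) {i : Fin m} {s : mo.syn}
    (h : sig mo (p.elem mo f) = ((toLex (i, s) : ModMon mo m) : WithBot (ModMon mo m))) :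
    p = .unit i ∨ .unit i ∉ S.P := by
  -- A monomial factor changes the exponent of a signature but not its position.
  have key : ∀ x ∈ S.G, ∀ c, sig mo ((monomial c (1 : K) : MvPolynomial σ K) • x) =
      ((toLex (i, s) : ModMon mo m) : WithBot (ModMon mo m)) → .unit i ∉ S.P := by
    intro x hx c hc
    obtain ⟨q, hq⟩ := WithBot.ne_bot_iff_exists.mp (sig_ne_bot mo f x (hS.proj_ne_zero x hx))
    obtain ⟨⟨j, t⟩, rfl⟩ := toLex.surjective q
    rw [sig_monomial_smul, ← hq, WithBot.map_coe] at hc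
    have hj : j = i := congrArg (fun q => (ofLex q).1) (WithBot.coe_injective hc)
    exact hS.unit_notMem x hx i t (hj ▸ hq.symm)
  cases p with
  | unit j =>
    left
    rw [Item.elem, sig_basisVec] at h
    have hj : j = i := congrArg (fun q => (ofLex q).1) (WithBot.coe_injective h)
    rw [hj]
  | pair x y =>
    right
    obtain ⟨hx, hy, -, hr⟩ := hS.pair_mem x y hp
    rw [Item.elem] at h
    rcases hr.sig_spair_eq_or with h' | h'
    · rw [h', sig_spairPart (hS.proj_ne_zero _ hx.mem), ← sig_monomial_smul] at h
      exact key _ hx.mem _ h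
    · rw [h', sig_spairPart (hS.proj_ne_zero _ hy.mem), ← sig_monomial_smul] at h
      exact key _ hy.mem _ h

theorem Invariant.rbStep (hlt : IsRewriteOrder mo f lt) (hS : Invariant mo f lt S)
    {S' : State σ K m} (h : RBStep mo f lt S S') : Invariant mo f lt S' := by
  cases h with
  | discard p hp hr =>
    refine hS.step hlt hp List.prefix_rfl subset_rfl subset_rfl hS.proj_ne_zero
      (hS.proj_updH p) ?_ (fun x y h => hS.pair_mem x y h.1) (fun x y hx hy _ _ _ => ⟨hx, hy⟩)
      (fun g hg i s h h' => hS.unit_notMem g hg i s h h'.1)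
    cases p with
    | unit i => exact Or.inl hr
    | pair x y => exact Or.inl hr
  | syzygy p γ hp hγ =>
    obtain ⟨hp, -, hred⟩ := hp
    refine hS.step hlt hp List.prefix_rfl (Set.subset_insert _ _) subset_rfl hS.proj_ne_zero
      ?_ ?_ (fun x y h => hS.pair_mem x y h.1) (fun x y hx hy _ _ _ => ⟨hx, hy⟩)
      (fun g hg i s h h' => hS.unit_notMem g hg i s h h'.1)
    · rintro h (rfl | hh)
      exacts [hγ, hS.proj_updH p h hh]
    · cases p with
      | unit i =>
        exact Or.inl ⟨γ, Set.mem_insert _ _, SigDvd.of_sig_eq hred.sig_eq⟩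
      | pair x y => exact Or.inr (Or.inl ⟨γ, Set.mem_insert _ _, hred.sig_eq⟩)
  | basis p γ hp hγ =>
    obtain ⟨hp, -, hred⟩ := hp
    have hmono : ∀ {x}, IsEntry S.G x → IsEntry (S.G ++ [γ]) x :=
      fun h => h.mono (List.prefix_append _ _)
    have hlast : IsEntry (S.G ++ [γ]) (S.G.length, γ) := isEntry_append_singleton.mpr (Or.inr rfl)
    refine hS.step hlt hp (List.prefix_append _ _) subset_rfl Set.subset_union_left ?_
      (hS.proj_updH p) ?_ ?_ ?_ ?_
    · intro g hg
      rcases List.mem_append.mp hg with hg | hg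
      · exact hS.proj_ne_zero g hg
      · rwa [List.mem_singleton.mp hg]
    · cases p with
      | unit i =>
        exact Or.inr ⟨γ, by simp, hred.sig_eq⟩
      | pair x y =>
        obtain ⟨hx, hy, -, -⟩ := hS.pair_mem x y hp.1
        -- The witness is `γ` itself, in last position. Reduction keeps its exponents below the
        -- least common multiple, where cancellation in the S-pair had put them.
        exact Or.inr (Or.inr ⟨_, hlast, hx.fst_lt, hy.fst_lt, hred.sig_eq,
          hred.degree_lt (fun d hd => lt_of_mem_support_proj_spair
            (hS.proj_ne_zero _ hx.mem) (hS.proj_ne_zero _ hy.mem) hd) hγ⟩)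
    · rintro x y (h | ⟨z, hz, hr, h⟩)
      · obtain ⟨hx, hy, h⟩ := hS.pair_mem x y h.1
        exact ⟨hmono hx, hmono hy, h⟩
      · cases h
        exact ⟨hmono hz, hlast, hz.fst_lt, hr⟩
    · intro x y hx hy hxy hr hn
      rcases isEntry_append_singleton.mp hy with hy' | rfl
      · refine ⟨?_, hy'⟩
        rcases isEntry_append_singleton.mp hx with hx' | rfl
        · exact hx'
        · exact absurd hxy hy'.fst_lt.asymm
      · rcases isEntry_append_singleton.mp hx with hx' | rfl
        · exact absurd (Or.inr ⟨x, hx', hr, rfl⟩) hn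
        · exact absurd hxy (lt_irrefl _)
    · rintro g hg i s hs (⟨h, hne⟩ | ⟨z, -, -, h⟩)
      · rcases List.mem_append.mp hg with hg | hg
        · exact hS.unit_notMem g hg i s hs h
        -- `γ` has the signature of `p`, so the unit vector in its position is `p`, now removed, or
        -- had left the pair set earlier.
        · rw [List.mem_singleton.mp hg, hred.sig_eq] at hs
          rcases hS.unit_notMem_of_sig_elem hp.1 hs with h' | h'
          exacts [hne h'.symm, h' h]
      · cases h

theorem RBReachable.invariant (hlt : IsRewriteOrder mo f lt) (h : RBReachable mo f lt S) :
    Invariant mo f lt S := by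
  induction h with
  | refl => exact invariant_initState
  | tail _ h ih => exact ih.rbStep hlt h

end Run

/-! ### Regular sequences -/

/-- Positions count from `0`, so `take i` lists exactly the generators before position `i`, and a
combination of them needs only those components. -/
theorem exists_proj_eq_of_mem_ofList {f : Fin m → MvPolynomial σ K} {i : ℕ}
    {r : MvPolynomial σ K} (h : r ∈ Ideal.ofList ((List.ofFn f).take i)) :
    ∃ α : FreeMod σ K m, (∀ j : Fin m, i ≤ j → α j = 0) ∧ proj f α = r := by
  induction h using Submodule.span_induction with
  | mem x hx =>
    obtain ⟨k, hk, rfl⟩ := List.mem_take_iff_getElem.mp hx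
    rw [lt_min_iff, List.length_ofFn] at hk
    refine ⟨basisVec σ K ⟨k, hk.2⟩, fun j hj => ?_, ?_⟩
    · refine Pi.single_eq_of_ne (fun h => ?_) _
      rw [h] at hj
      exact hj.not_gt hk.1
    · simp [proj_basisVec]
  | zero => exact ⟨0, fun _ _ => rfl, proj_zero f⟩
  | add x y _ _ hx hy =>
    obtain ⟨α, hα, rfl⟩ := hx
    obtain ⟨β, hβ, rfl⟩ := hy
    exact ⟨α + β, fun j hj => by simp [hα j hj, hβ j hj], by simp [proj, add_mul,
      Finset.sum_add_distrib]⟩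
  | smul a x _ hx =>
    obtain ⟨α, hα, rfl⟩ := hx
    exact ⟨a • α, fun j hj => by simp [hα j hj], proj_smul f a α⟩

/-- Regularity enters here: `γ i * f i` is minus the sum of the `γ j * f j` with `j < i`, and `f i`
is a non-zero-divisor modulo the earlier generators. -/
theorem mem_ofList_of_proj_eq_zero {f : Fin m → MvPolynomial σ K}
    (hf : RingTheory.Sequence.IsWeaklyRegular (MvPolynomial σ K) (List.ofFn f)) {i : Fin m}
    {γ : FreeMod σ K m} (hγ : ∀ j, i < j → γ j = 0) (h : proj f γ = 0) :
    γ i ∈ Ideal.ofList ((List.ofFn f).take i) := by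
  classical
  have hreg := hf.regular_mod_prev i (by simp)
  rw [isSMulRegular_quotient_iff_mem_of_smul_mem] at hreg
  have hreg' := hreg (γ i)
  simp only [smul_eq_mul, Ideal.mul_top, List.getElem_ofFn, Fin.eta] at hreg'
  refine hreg' ?_
  rw [proj, ← Finset.add_sum_erase _ _ (Finset.mem_univ i), add_eq_zero_iff_eq_neg, mul_comm] at h
  rw [h]
  refine neg_mem (sum_mem fun j hj => ?_)
  rcases lt_or_gt_of_ne (Finset.ne_of_mem_erase hj) with hlt | hgt
  · refine Ideal.mul_mem_left _ _ (Ideal.subset_span ?_)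
    exact List.mem_take_iff_getElem.mpr ⟨j, by simpa using hlt, by simp⟩
  · rw [hγ j hgt, zero_mul]
    exact zero_mem _

end SigGB

/-! ### Absence of reductions to zero -/

theorem mainTheorem2 {σ K : Type*} [Finite σ] [Field K] (mo : MonomialOrder σ) {m : ℕ}
    (f : Fin m → MvPolynomial σ K)
    (hf : RingTheory.Sequence.IsWeaklyRegular (MvPolynomial σ K) (List.ofFn f))
    (lt : SigGB.Entry σ K m → SigGB.Entry σ K m → Prop)
    (hlt : SigGB.IsRewriteOrder mo f lt)
    (S : SigGB.State σ K m) (hS : SigGB.RBReachable mo f lt S)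
    (p : SigGB.Item σ K m) (γ : SigGB.FreeMod σ K m)
    (hγ : SigGB.PerformsReduction mo f lt S p γ) :
    SigGB.proj f γ ≠ 0 := by
  intro h0
  have inv := SigGB.RBReachable.invariant hlt hS
  obtain ⟨hp, hr, hred⟩ := hγ
  have hsig := hred.sig_eq
  have hbot : SigGB.sig mo (p.elem mo f) ≠ ⊥ := by
    cases p with
    | unit i => simp [SigGB.Item.elem, SigGB.sig_basisVec]
    | pair x y =>
      obtain ⟨hx, hy, -, hxy⟩ := inv.pair_mem x y hp.1
      have hle := SigGB.le_map_shift (mo := mo) (m := m)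
      rcases hxy.sig_spair_eq_or with h | h
      · rw [SigGB.Item.elem, h, SigGB.sig_spairPart (inv.proj_ne_zero _ hx.mem)]
        exact ((bot_lt_iff_ne_bot.mpr
          (SigGB.sig_ne_bot mo f _ (inv.proj_ne_zero _ hx.mem))).trans_le (hle _ _)).ne'
      · rw [SigGB.Item.elem, h, SigGB.sig_spairPart (inv.proj_ne_zero _ hy.mem)]
        exact ((bot_lt_iff_ne_bot.mpr
          (SigGB.sig_ne_bot mo f _ (inv.proj_ne_zero _ hy.mem))).trans_le (hle _ _)).ne'
  obtain ⟨q, hq⟩ := WithBot.ne_bot_iff_exists.mp hbot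
  obtain ⟨⟨i, s⟩, rfl⟩ := toLex.surjective q
  -- Either `p` is `e_i`, and its Koszul syzygies enter with `updH`, or `e_i` was treated before.
  have hK : SigGB.KoszulDone mo f (S.updH f p) i := by
    rcases inv.unit_notMem_of_sig_elem hp.1 hq.symm with h | h
    · rw [h] at hp ⊢
      exact inv.koszulDone_updH hlt hp
    · exact (inv.koszul_done i h).mono (SigGB.State.subset_updH p)
  obtain ⟨hγi, hdeg, hγj⟩ := SigGB.sig_eq_coe_iff.mp (hsig.trans hq.symm)
  obtain ⟨α, hα, hpα⟩ := SigGB.exists_proj_eq_of_mem_ofList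
    (SigGB.mem_ofList_of_proj_eq_zero hf hγj h0)
  obtain ⟨h, hh, hd⟩ := hK α (SigGB.sig_lt_sig_basisVec_iff.mpr hα) (hpα ▸ hγi)
  -- The lead exponent of `γ i` is the exponent in the signature of `p`, so `h` makes `p`
  -- rewritable; for an S-pair, through the part that carries its signature.
  rw [hpα, hdeg, hq] at hd
  apply hr
  cases p with
  | unit j => exact ⟨h, hh, hd⟩
  | pair x y =>
    obtain ⟨-, -, -, hxy⟩ := inv.pair_mem x y hp.1
    rw [SigGB.Item.elem] at hd
    rcases hxy.sig_spair_eq_or with h' | h'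
    · exact Or.inl (Or.inl ⟨h, hh, h' ▸ hd⟩)
    · exact Or.inr (Or.inl ⟨h, hh, h' ▸ hd⟩)
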